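/- **Definitions.** A Hausdorff space $Y$ is *stratifiable* if to every open $U\subset Y$ one can assign a sequence $(U_n)_{n\ge 1}$ of open subsets of $Y$ such that $\overline{U_n}\subset U$, $\bigcup_n U_n=U$, and $U_n\subset V_n$ for all $n$ whenever $U\subset V$. For a topological space $X$, the *squeezed join* $SJ(X)$ is the quotient set of $X\times X\times[0,1]$ by the equivalence relation generated by $(x,y,0)\sim(x,y',0)$, $(x,y,1)\sim(x',y,1)$, $(x,x,t)\sim(x,x,t')$. Write $[x,y;t]$ for the class of $(x,y,t)$ and identify $x\in X$ with $[x,x;0]$. Basic neighbourhoods of a point $[x,y;t]\notin X$ are the sets $\{[x',y';t'] : x'\in U_x,\ y'\in U_y,\ t'\in U_t\}$, where $U_x,U_y,U_t$ are neighbourhoods of $x,y,t$. Basic neighbourhoods of $x\in X$ are the sets $\{[x',y';t'] : (x',y',t')\in U\times U\times[0,1]\,\cup\, U\times X\times[0,\varepsilon)\,\cup\, X\times U\times(1-\varepsilon,1]\}$, where $\varepsilon>0$ and $U$ is a neighbourhood of $x$ in $X$. Let $SJ^0(X)=X$, $SJ^n(X)=SJ(SJ^{n-1}(X))$ for $n\ge1$,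 and $SJ^\infty(X)=\bigcup_n SJ^n(X)$ along the inclusions $SJ^{n-1}(X)\subset SJ^n(X)$. For $a,b\in SJ^{k-1}(X)$ let $[a,b]_k=\{[a,b;t]:t\in[0,1]\}\subset SJ^k(X)$. A set $U\subset SJ^\infty(X)$ is *convex* if there is $n$ such that $[a,b]_k\subset U$ for all $k\ge n$ and all $a,b\in U\cap SJ^{k-1}(X)$. The topology of $SJ^\infty(X)$ has as base the convex sets $U$ such that $U\cap SJ^n(X)$ is open in $SJ^n(X)$ for every $n$. The *support* $\operatorname{supp}(a)\subset X$ of $a\in SJ^\infty(X)$ is defined inductively by $\operatorname{supp}(a)=\{a\}$ for $a\in X$, and $\operatorname{supp}(a)=\operatorname{supp}(x)\cup\operatorname{supp}(y)$ for $a=[x,y;t]\in SJ^n(X)\setminus SJ^{n-1}(X)$ with $x,y\in SJ^{n-1}(X)$. Finally, $\dim$ is the covering dimension: $\dim Z\le n$ means that every finite open cover of $Z$ has a finite open refinement covering $Z$ such that each point of $Z$ lies in at most $n+1$ of its members. **Lemma 3.1.** Let $Y$ be a stratifiable space and $X\subset Y$ a nonempty closed subset. Then there exist a continuous map $f:Y\to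 SJ^\infty(X)$ with $f(x)=x$ for all $x\in X$, and a map $u$ from $Y$ to the set of finite subsets of $X$ that is upper semicontinuous, i.e. $\{y\in Y: u(y)\subset U\}$ is open in $Y$ for every open $U\subset X$, such that $u(x)=\{x\}$ for all $x\in X$ and $\operatorname{supp}(f(y))\subset u(y)$ for all $y\in Y$. Moreover, $f$ and $u$ can be chosen so that, for every integer $n\ge0$ with $\dim(Y\setminus X)\le n$, one has $f(Y)\subset SJ^n(X)$. -/

import Mathlib

universe u

/-- A stratifiable space: a Hausdorff space in which every open set `U` is assigned a sequence
`S U 0, S U 1, …` of open sets with closures inside `U` and union `U`, monotonically in `U`. -/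
structure IsStratifiable (Y : Type u) [TopologicalSpace Y] : Prop where
  t2 : T2Space Y
  exists_stratification : ∃ S : TopologicalSpace.Opens Y → ℕ → TopologicalSpace.Opens Y,
    (∀ U n, closure (S U n : Set Y) ⊆ (U : Set Y)) ∧
    (∀ U, (⋃ n, (S U n : Set Y)) = (U : Set Y)) ∧
    (∀ U V, U ≤ V → ∀ n, S U n ≤ S V n)

/-- `dim Z ≤ n` for the (Čech–Lebesgue) covering dimension: every finite open cover of `Z` has a
finite open refinement such that each point lies in at most `n + 1` of its members. -/
def CoveringDimLE (Z : Type u) [TopologicalSpace Z] (n : ℕ) : Prop :=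
  ∀ 𝒰 : Set (Set Z), 𝒰.Finite → (∀ U ∈ 𝒰, IsOpen U) → ⋃₀ 𝒰 = Set.univ →
    ∃ 𝒱 : Set (Set Z), 𝒱.Finite ∧ (∀ V ∈ 𝒱, IsOpen V) ∧ ⋃₀ 𝒱 = Set.univ ∧
      (∀ V ∈ 𝒱, ∃ U ∈ 𝒰, V ⊆ U) ∧
      ∀ z : Z, {V | V ∈ 𝒱 ∧ z ∈ V}.encard ≤ (n : ℕ∞) + 1

/-- The identifications on `X × X × [0,1]` that generate the equivalence relation of the squeezed
join. -/
inductive SqueezedJoinRel (X : Type u) : X × X × unitInterval → X × X × unitInterval → Prop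
  | left (x y y' : X) : SqueezedJoinRel X (x, y, 0) (x, y', 0)
  | right (x x' y : X) : SqueezedJoinRel X (x, y, 1) (x', y, 1)
  | diag (x : X) (t t' : unitInterval) : SqueezedJoinRel X (x, x, t) (x, x, t')

/-- The squeezed join `SJ(X)` as a set: the quotient of `X × X × [0,1]` by the equivalence
relation generated by `SqueezedJoinRel`. -/
def SqueezedJoin (X : Type u) : Type u := Quot (SqueezedJoinRel X)

namespace SqueezedJoin

variable {X : Type u}

/-- The point `[x, y; t]` of the squeezed join. -/
def mk (x y : X) (t : unitInterval) : SqueezedJoin X := Quot.mk _ (x, y, t)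

/-- The inclusion `X → SJ(X)`, `x ↦ [x, x; 0]`. -/
def incl (x : X) : SqueezedJoin X := mk x x 0

open Classical in
/-- An auxiliary retraction of the set `SJ(X)` onto `X`, used to see that `incl` is injective. -/
noncomputable def retr : SqueezedJoin X → X :=
  Quot.lift (fun p => if p.2.2 = 1 then p.2.1 else p.1) (by
    rintro _ _ (⟨x, y, y'⟩ | ⟨x, x', y⟩ | ⟨x, t, t'⟩)
    · simp
    · simp
    · simp)

theorem incl_injective : Function.Injective (incl : X → SqueezedJoin X) := by
  have h : ∀ x : X, retr (incl x) = x := fun x => by simp [retr, incl, mk]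
  exact Function.LeftInverse.injective h

/-- The set `[A, B; T]` of all `[x', y'; t']` with `x' ∈ A`, `y' ∈ B`, `t' ∈ T`. -/
def box (A B : Set X) (T : Set unitInterval) : Set (SqueezedJoin X) :=
  {a | ∃ x ∈ A, ∃ y ∈ B, ∃ t ∈ T, a = mk x y t}

/-- The set `[U, ε]` of all `[x', y'; t']` with
`(x', y', t') ∈ U × U × [0,1] ∪ U × X × [0, ε) ∪ X × U × (1 - ε, 1]`. -/
def conicNhd (U : Set X) (ε : ℝ) : Set (SqueezedJoin X) :=
  box U U Set.univ ∪ box U Set.univ {t | (t : ℝ) < ε} ∪ box Set.univ U {t | 1 - ε < (t : ℝ)}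

theorem conicNhd_mono {U U' : Set X} {ε ε' : ℝ} (hU : U ⊆ U') (hε : ε ≤ ε') :
    conicNhd U ε ⊆ conicNhd U' ε' := by
  rintro a ((⟨x, hx, y, hy, t, ht, rfl⟩ | ⟨x, hx, y, hy, t, ht, rfl⟩) |
    ⟨x, hx, y, hy, t, ht, rfl⟩)
  · exact Or.inl (Or.inl ⟨x, hU hx, y, hU hy, t, ht, rfl⟩)
  · exact Or.inl (Or.inr ⟨x, hU hx, y, hy, t, lt_of_lt_of_le ht hε, rfl⟩)
  · refine Or.inr ⟨x, hx, y, hU hy, t, ?_, rfl⟩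
    have h1 : 1 - ε < (t : ℝ) := ht
    show 1 - ε' < (t : ℝ)
    linarith

theorem box_mono {A A' B B' : Set X} {T T' : Set unitInterval} (hA : A ⊆ A') (hB : B ⊆ B')
    (hT : T ⊆ T') : box A B T ⊆ box A' B' T' := by
  rintro a ⟨x, hx, y, hy, t, ht, rfl⟩
  exact ⟨x, hA hx, y, hB hy, t, hT ht, rfl⟩

/-- The topology of the squeezed join. A set is open when it contains, with each of its points,
a basic neighbourhood of that point: some `[U_x, U_y; U_t]` for a point `[x, y; t]` outside `X`,
and some `[U, ε]` for a point `x` of `X`. (For Hausdorff `X` these sets do form neighbourhood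
bases of this topology, which is then Hausdorff again.) -/
instance [TopologicalSpace X] : TopologicalSpace (SqueezedJoin X) where
  IsOpen V :=
    (∀ (x y : X) (t : unitInterval), mk x y t ∉ Set.range (incl : X → SqueezedJoin X) →
      mk x y t ∈ V → ∃ A ∈ nhds x, ∃ B ∈ nhds y, ∃ T ∈ nhds t, box A B T ⊆ V) ∧
    (∀ x : X, incl x ∈ V → ∃ U ∈ nhds x, ∃ ε : ℝ, 0 < ε ∧ conicNhd U ε ⊆ V)
  isOpen_univ :=
    ⟨fun _ _ _ _ _ => ⟨Set.univ, Filter.univ_mem, Set.univ, Filter.univ_mem, Set.univ,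
        Filter.univ_mem, Set.subset_univ _⟩,
      fun _ _ => ⟨Set.univ, Filter.univ_mem, 1, one_pos, Set.subset_univ _⟩⟩
  isOpen_inter := by
    rintro V W ⟨hV, hV'⟩ ⟨hW, hW'⟩
    refine ⟨fun x y t h hm => ?_, fun x hm => ?_⟩
    · obtain ⟨A, hA, B, hB, T, hT, h1⟩ := hV x y t h hm.1
      obtain ⟨A', hA', B', hB', T', hT', h2⟩ := hW x y t h hm.2
      exact ⟨A ∩ A', Filter.inter_mem hA hA', B ∩ B', Filter.inter_mem hB hB', T ∩ T',
        Filter.inter_mem hT hT', Set.subset_inter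
          ((box_mono Set.inter_subset_left Set.inter_subset_left Set.inter_subset_left).trans h1)
          ((box_mono Set.inter_subset_right Set.inter_subset_right
            Set.inter_subset_right).trans h2)⟩
    · obtain ⟨U, hU, ε, hε, h1⟩ := hV' x hm.1
      obtain ⟨U', hU', ε', hε', h2⟩ := hW' x hm.2
      exact ⟨U ∩ U', Filter.inter_mem hU hU', min ε ε', lt_min hε hε', Set.subset_inter
        ((conicNhd_mono Set.inter_subset_left (min_le_left _ _)).trans h1)
        ((conicNhd_mono Set.inter_subset_right (min_le_right _ _)).trans h2)⟩
  isOpen_sUnion := by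
    intro 𝒮 h𝒮
    refine ⟨fun x y t h hm => ?_, fun x hm => ?_⟩
    · obtain ⟨V, hV, hm⟩ := hm
      obtain ⟨A, hA, B, hB, T, hT, h1⟩ := (h𝒮 V hV).1 x y t h hm
      exact ⟨A, hA, B, hB, T, hT, h1.trans (Set.subset_sUnion_of_mem hV)⟩
    · obtain ⟨V, hV, hm⟩ := hm
      obtain ⟨U, hU, ε, hε, h1⟩ := (h𝒮 V hV).2 x hm
      exact ⟨U, hU, ε, hε, h1.trans (Set.subset_sUnion_of_mem hV)⟩

/-- The support of a point of `SJ(X)`: it is `{x}` for `x ∈ X`, and `{x, y}` for a point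
`[x, y; t]` outside `X` (which has only this one representation). -/
def supp (a : SqueezedJoin X) : Set X :=
  {z | a = incl z ∨ (a ∉ Set.range (incl : X → SqueezedJoin X) ∧
    ∃ (x y : X) (t : unitInterval), a = mk x y t ∧ (z = x ∨ z = y))}

theorem supp_incl (x : X) : supp (incl x) = {x} := by
  ext z
  constructor
  · rintro (h | ⟨h, -⟩)
    · exact (incl_injective h).symm
    · exact absurd ⟨x, rfl⟩ h
  · rintro rfl
    exact Or.inl rfl

end SqueezedJoin

/-- The iterated squeezed joins: `SJ^0(X) = X`, `SJ^(n+1)(X) = SJ(SJ^n(X))`. -/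
def SJPow (X : Type u) : ℕ → Type u
  | 0 => X
  | n + 1 => SqueezedJoin (SJPow X n)

namespace SJPow

instance instTopologicalSpace (X : Type u) [TopologicalSpace X] :
    ∀ n : ℕ, TopologicalSpace (SJPow X n)
  | 0 => inferInstanceAs (TopologicalSpace X)
  | n + 1 =>
    haveI : TopologicalSpace (SJPow X n) := instTopologicalSpace X n
    inferInstanceAs (TopologicalSpace (SqueezedJoin (SJPow X n)))

variable {X : Type u}

/-- The point `[a, b; t]` of `SJ^(n+1)(X)` for points `a`, `b` of `SJ^n(X)`. -/
def mk {n : ℕ} (a b : SJPow X n) (t : unitInterval) : SJPow X (n + 1) := SqueezedJoin.mk a b t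

/-- The inclusion of `SJ^n(X)` into `SJ^(n+1)(X)`. -/
def incl {n : ℕ} (a : SJPow X n) : SJPow X (n + 1) := SqueezedJoin.incl a

/-- The support in `X` of a point of `SJ^n(X)`: `supp a = {a}` for `a ∈ X = SJ^0(X)`, and for a
point `a` of `SJ^(n+1)(X)` the union of the supports of the points of `SJ^n(X)` that form the
support of `a` in the sense of a single squeezed join. -/
def supp : (n : ℕ) → SJPow X n → Set X
  | 0, a => {(show X from a)}
  | n + 1, a => ⋃ b ∈ SqueezedJoin.supp (X := SJPow X n) a, supp n b

theorem supp_incl {n : ℕ} (a : SJPow X n) : supp (n + 1) (incl a) = supp n a := by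
  show (⋃ b ∈ SqueezedJoin.supp (SqueezedJoin.incl a), supp n b) = supp n a
  rw [SqueezedJoin.supp_incl]
  simp

end SJPow

/-- The identification of each `SJ^n(X)` with a subset of `SJ^(n+1)(X)`. -/
inductive SJInftyRel (X : Type u) : (Σ n, SJPow X n) → (Σ n, SJPow X n) → Prop
  | incl (n : ℕ) (a : SJPow X n) : SJInftyRel X ⟨n, a⟩ ⟨n + 1, SJPow.incl a⟩

/-- `SJ^∞(X)` as a set: the union of the increasing sequence `X ⊆ SJ^1(X) ⊆ SJ^2(X) ⊆ …`. -/
def SJInfty (X : Type u) : Type u := Quot (SJInftyRel X)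

namespace SJInfty

variable {X : Type u}

/-- The inclusion `SJ^n(X) → SJ^∞(X)`. -/
def of (n : ℕ) (a : SJPow X n) : SJInfty X := Quot.mk _ ⟨n, a⟩

/-- The inclusion `X → SJ^∞(X)`. -/
def incl (x : X) : SJInfty X := of 0 x

/-- `U` is convex: for all sufficiently large `k`, it contains the segment `[a, b]` in
`SJ^(k+1)(X)` whenever it contains the points `a`, `b` of `SJ^k(X)`. -/
def IsConvex (U : Set (SJInfty X)) : Prop :=
  ∃ n : ℕ, ∀ k ≥ n, ∀ a b : SJPow X k, of k a ∈ U → of k b ∈ U →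
    ∀ t : unitInterval, of (k + 1) (SJPow.mk a b t) ∈ U

/-- The topology of `SJ^∞(X)`: its base consists of the convex sets that meet every `SJ^n(X)` in
an open set. (The intersection of two such sets is again such a set.) -/
instance [TopologicalSpace X] : TopologicalSpace (SJInfty X) :=
  TopologicalSpace.generateFrom {U | IsConvex U ∧ ∀ n : ℕ, IsOpen (of n ⁻¹' U)}

/-- The support in `X` of a point of `SJ^∞(X)`. -/
def supp : SJInfty X → Set X :=
  Quot.lift (fun a => SJPow.supp a.1 a.2) (by
    rintro _ _ ⟨n, a⟩
    exact (SJPow.supp_incl a).symm)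

end SJInfty

open Set Topology TopologicalSpace

theorem IsStratifiable.exists_monotone {Y : Type u} [TopologicalSpace Y] (hY : IsStratifiable Y) :
    ∃ S : Opens Y → ℕ → Opens Y,
      (∀ U n, closure (S U n : Set Y) ⊆ U) ∧ (∀ U, ∀ x ∈ U, ∃ n, x ∈ S U n) ∧
      (∀ U V, U ≤ V → ∀ n, S U n ≤ S V n) ∧ ∀ U, Monotone (S U) := by
  obtain ⟨S, hcl, hun, hmono⟩ := hY.exists_stratification
  refine ⟨fun U n => partialSups (S U) n, fun U n => ?_, fun U x hx => ?_, fun U V h n => ?_,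
    fun U => (partialSups (S U)).monotone⟩
  · induction n with
    | zero => simpa using hcl U 0
    | succ n ih =>
      show closure (partialSups (S U) (n + 1) : Set Y) ⊆ U
      rw [partialSups_add_one, Opens.coe_sup, closure_union]
      exact union_subset ih (hcl U (n + 1))
  · have : x ∈ ⋃ n, (S U n : Set Y) := by rw [hun]; exact hx
    obtain ⟨n, hn⟩ := mem_iUnion.1 this
    exact ⟨n, le_partialSups (S U) n hn⟩
  · exact partialSups_mono (fun n => hmono U V h n) n

/-- The operator witnessing monotone normality: `sepNhd S A B` is an open neighbourhood of the
closed set `Aᶜ` when `Aᶜ ⊆ B`. -/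
def sepNhd {Y : Type u} [TopologicalSpace Y] (S : Opens Y → ℕ → Opens Y) (A B : Opens Y) : Set Y :=
  ⋃ n, ((S B n : Set Y) \ closure (S A n : Set Y))

section sepNhd

variable {Y : Type u} [TopologicalSpace Y] {S : Opens Y → ℕ → Opens Y}

theorem isOpen_sepNhd (A B : Opens Y) : IsOpen (sepNhd S A B) :=
  isOpen_iUnion fun n => (S B n).isOpen.sdiff isClosed_closure

theorem compl_subset_sepNhd (hcl : ∀ U n, closure (S U n : Set Y) ⊆ U)
    (hun : ∀ U, ∀ x ∈ U, ∃ n, x ∈ S U n) {A B : Opens Y} (h : (A : Set Y)ᶜ ⊆ B) :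
    (A : Set Y)ᶜ ⊆ sepNhd S A B := by
  intro x hx
  obtain ⟨n, hn⟩ := hun B x (h hx)
  exact mem_iUnion.2 ⟨n, hn, fun h' => hx (hcl A n h')⟩

theorem disjoint_sepNhd_swap (hS : ∀ U, Monotone (S U)) (A B : Opens Y) :
    Disjoint (sepNhd S A B) (sepNhd S B A) := by
  rw [Set.disjoint_left]
  intro x h1 h2
  obtain ⟨n, hn, hn'⟩ := mem_iUnion.1 h1
  obtain ⟨m, hm, hm'⟩ := mem_iUnion.1 h2
  rcases le_total n m with h | h
  · exact hm' (subset_closure (hS B h hn))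
  · exact hn' (subset_closure (hS A h hm))

theorem sepNhd_mono (hmono : ∀ U V, U ≤ V → ∀ n, S U n ≤ S V n) {A A' B B' : Opens Y}
    (hA : A' ≤ A) (hB : B ≤ B') : sepNhd S A B ⊆ sepNhd S A' B' :=
  iUnion_mono fun n => sdiff_subset_sdiff (hmono B B' hB n) (closure_mono (hmono A' A hA n))

end sepNhd

theorem IsStratifiable.normalSpace {Y : Type u} [TopologicalSpace Y] (hY : IsStratifiable Y) :
    NormalSpace Y := by
  obtain ⟨S, hcl, hun, hmono, hS⟩ := hY.exists_monotone
  refine ⟨fun s t hs ht hst => ?_⟩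
  let A : Opens Y := ⟨sᶜ, hs.isOpen_compl⟩
  let B : Opens Y := ⟨tᶜ, ht.isOpen_compl⟩
  refine ⟨sepNhd S A B, sepNhd S B A, isOpen_sepNhd _ _, isOpen_sepNhd _ _, ?_, ?_,
    disjoint_sepNhd_swap hS A B⟩
  · simpa [A] using compl_subset_sepNhd hcl hun (A := A) (B := B)
      (by simpa [A, B] using hst.subset_compl_right)
  · simpa [B] using compl_subset_sepNhd hcl hun (A := B) (B := A)
      (by simpa [A, B] using hst.subset_compl_left)

theorem IsStratifiable.of_isOpen {Y : Type u} [TopologicalSpace Y] (hY : IsStratifiable Y)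
    {W : Set Y} (hW : IsOpen W) : IsStratifiable W := by
  obtain ⟨S, hcl, hun, hmono⟩ := hY.exists_stratification
  have := hY.t2
  let e : Opens W → Opens Y := fun U => ⟨Subtype.val '' (U : Set W),
    hW.isOpenMap_subtype_val _ U.isOpen⟩
  have he : ∀ U : Opens W, Subtype.val ⁻¹' (e U : Set Y) = (U : Set W) := fun U =>
    preimage_image_eq _ Subtype.val_injective
  refine ⟨inferInstance, fun U n => ⟨Subtype.val ⁻¹' (S (e U) n : Set Y),
    (S (e U) n).isOpen.preimage continuous_subtype_val⟩, fun U n => ?_, fun U => ?_,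
    fun U V h n => ?_⟩
  · refine (continuous_subtype_val.closure_preimage_subset _).trans ?_
    conv_rhs => rw [← he U]
    exact preimage_mono (hcl _ _)
  · conv_rhs => rw [← he U, ← hun]
    rw [preimage_iUnion]
    rfl
  · exact preimage_mono (f := Subtype.val) (hmono (e U) (e V) (image_mono h) n)

/-- In a stratifiable space, a discrete family of sets has a locally finite open expansion that is
controlled by a continuous function. -/
theorem IsStratifiable.exists_expansion {Y : Type u} [TopologicalSpace Y] (hY : IsStratifiable Y)
    {ι : Type*} {C U : ι → Set Y} (hU : ∀ a, IsOpen (U a)) (hCU : ∀ a, closure (C a) ⊆ U a)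
    (hC : ∀ y, ∃ O ∈ 𝓝 y, ∃ r, ∀ a ≠ r, Disjoint O (C a)) :
    ∃ (h : Y → ℝ) (T : ι → Set Y), Continuous h ∧ (∀ a, IsOpen (T a)) ∧ LocallyFinite T ∧
      (∀ a, T a ⊆ U a) ∧ (∀ y, 0 < h y → ∃ a, y ∈ T a) ∧ ∀ a, ∀ y ∈ C a, 0 < h y := by
  have := hY.normalSpace
  obtain ⟨S, hcl, hun, hmono, hS⟩ := hY.exists_monotone
  let A : ι → Opens Y := fun a => ⟨(closure (C a))ᶜ, isClosed_closure.isOpen_compl⟩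
  let B : ι → Opens Y := fun a => ⟨(closure (⋃ b ∈ {b | b ≠ a}, C b))ᶜ,
    isClosed_closure.isOpen_compl⟩
  have hAc : ∀ a, (A a : Set Y)ᶜ = closure (C a) := fun a => compl_compl _
  have hAB : ∀ a, (A a : Set Y)ᶜ ⊆ B a := by
    intro a y hy hy'
    rw [hAc] at hy
    obtain ⟨O, hO, r, hr⟩ := hC y
    have har : a = r := by
      by_contra h
      obtain ⟨z, hz, hz'⟩ := mem_closure_iff_nhds.1 hy O hO
      exact Set.disjoint_left.1 (hr a h) hz hz'
    obtain ⟨z, hz, hz'⟩ := mem_closure_iff_nhds.1 hy' O hO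
    obtain ⟨b, hb, hzb⟩ := mem_iUnion₂.1 hz'
    exact Set.disjoint_left.1 (hr b (har ▸ hb)) hz hzb
  have hBA : ∀ a b, a ≠ b → B a ≤ A b := fun a b hab =>
    compl_subset_compl.2 (closure_mono (subset_biUnion_of_mem (u := C) hab.symm))
  let E : ι → Set Y := fun a => sepNhd S (A a) (B a) ∩ U a
  have hE : ∀ a, IsOpen (E a) := fun a => (isOpen_sepNhd _ _).inter (hU a)
  have hEd : ∀ a b, a ≠ b → Disjoint (E a) (E b) := fun a b hab =>
    ((disjoint_sepNhd_swap hS (A a) (B a)).mono_right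
      (sepNhd_mono hmono (hBA a b hab) (hBA b a hab.symm))).mono inter_subset_left
        inter_subset_left
  have hCE : ∀ a, closure (C a) ⊆ E a := fun a =>
    subset_inter (hAc a ▸ compl_subset_sepNhd hcl hun (hAB a)) (hCU a)
  have hD : closure (⋃ a, C a) ⊆ ⋃ a, E a := by
    intro y hy
    obtain ⟨O, hO, r, hr⟩ := hC y
    refine mem_iUnion.2 ⟨r, hCE r ?_⟩
    rw [mem_closure_iff_nhds] at hy ⊢
    intro M hM
    obtain ⟨z, ⟨hzM, hzO⟩, hz⟩ := hy _ (Filter.inter_mem hM hO)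
    obtain ⟨a, ha⟩ := mem_iUnion.1 hz
    by_cases har : a = r
    · exact ⟨z, hzM, har ▸ ha⟩
    · exact absurd ha (Set.disjoint_left.1 (hr a har) hzO)
  obtain ⟨h, h0, h1, -⟩ := exists_continuous_zero_one_of_isClosed
    (s := (⋃ a, E a)ᶜ) (t := closure (⋃ a, C a)) (isOpen_iUnion hE).isClosed_compl
    isClosed_closure (disjoint_compl_left_iff_subset.2 hD)
  refine ⟨fun y => h y - 1 / 2, fun a => E a ∩ {y | 1 / 2 < h y}, by fun_prop,
    fun a => (hE a).inter (isOpen_lt continuous_const h.continuous), fun y => ?_,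
    fun a => inter_subset_left.trans inter_subset_right, fun y hy => ?_, fun a y hy => ?_⟩
  · by_cases hy : h y < 1 / 2
    · refine ⟨{z | h z < 1 / 2}, (isOpen_lt h.continuous continuous_const).mem_nhds hy, ?_⟩
      refine Set.finite_empty.subset ?_
      rintro a ⟨z, ⟨-, hz⟩, hz'⟩
      exact lt_asymm (show 1 / 2 < h z from hz) hz'
    · have hyE : y ∈ ⋃ a, E a := by
        by_contra hc
        exact hy (by rw [h0 hc]; norm_num)
      obtain ⟨r, hr⟩ := mem_iUnion.1 hyE
      refine ⟨E r, (hE r).mem_nhds hr, (finite_singleton r).subset ?_⟩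
      rintro a ⟨z, ⟨hz, -⟩, hz'⟩
      by_contra hne
      exact Set.disjoint_left.1 (hEd a r hne) hz hz'
  · have hy' : 1 / 2 < h y := by simpa using hy
    have hyE : y ∈ ⋃ a, E a := by
      by_contra hc
      rw [h0 hc] at hy'
      norm_num at hy'
    obtain ⟨r, hr⟩ := mem_iUnion.1 hyE
    exact ⟨r, hr, hy'⟩
  · have : h y = 1 := h1 (subset_closure (mem_iUnion.2 ⟨a, hy⟩))
    show 0 < h y - 1 / 2
    rw [this]; norm_num

theorem exists_locallyFinite_of_sigma {Y : Type u} [TopologicalSpace Y] {ι : Type*}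
    {h : ℕ → Y → ℝ} {T : ℕ → ι → Set Y} (hh : ∀ n, Continuous (h n))
    (hT : ∀ n a, IsOpen (T n a)) (hlf : ∀ n, LocallyFinite (T n))
    (hhT : ∀ n y, 0 < h n y → ∃ a, y ∈ T n a) (hpos : ∀ y, ∃ n, 0 < h n y) :
    ∃ R : ℕ × ι → Set Y, (∀ b, IsOpen (R b)) ∧ (⋃ b, R b) = univ ∧ LocallyFinite R ∧
      ∀ b, R b ⊆ T b.1 b.2 := by
  refine ⟨fun b => T b.1 b.2 ∩ ⋂ i ∈ Finset.range b.1, {y | h i y < 1 / ((b.1 : ℝ) + 1)},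
    fun b => (hT _ _).inter ((Finset.range b.1).finite_toSet.isOpen_biInter fun i _ =>
      isOpen_lt (hh i) continuous_const), ?_, fun y => ?_, fun b => inter_subset_left⟩
  · refine eq_univ_of_forall fun y => ?_
    classical
    obtain ⟨a, ha⟩ := hhT _ y (Nat.find_spec (hpos y))
    refine mem_iUnion.2 ⟨(Nat.find (hpos y), a), ha, mem_iInter₂.2 fun i hi => ?_⟩
    have := Nat.find_min (hpos y) (Finset.mem_range.1 hi)
    exact lt_of_le_of_lt (not_lt.1 this) (by positivity)
  · obtain ⟨i, hi⟩ := hpos y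
    obtain ⟨N₀, hN₀⟩ := exists_nat_one_div_lt hi
    choose M hM hMf using fun n => hlf n y
    let N := max N₀ (i + 1)
    refine ⟨{z | 1 / ((N₀ : ℝ) + 1) < h i z} ∩ ⋂ n ∈ Finset.range N, M n,
      Filter.inter_mem ((isOpen_lt continuous_const (hh i)).mem_nhds hN₀)
        ((Filter.biInter_finset_mem _).2 fun n _ => hM n), ?_⟩
    refine ((Finset.range N).finite_toSet.biUnion fun n _ =>
      (hMf n).image (Prod.mk n)).subset ?_
    rintro ⟨n, a⟩ ⟨z, ⟨hzT, hz⟩, hzi, hzM⟩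
    have hzi : 1 / ((N₀ : ℝ) + 1) < h i z := hzi
    have hn : n < N := by
      by_contra hn
      have hn : max N₀ (i + 1) ≤ n := not_lt.1 hn
      have h1 : h i z < 1 / ((n : ℝ) + 1) :=
        mem_iInter₂.1 hz i (Finset.mem_range.2 (by dsimp only; omega))
      have h2 : (1 : ℝ) / ((n : ℝ) + 1) ≤ 1 / ((N₀ : ℝ) + 1) :=
        Nat.one_div_le_one_div (by omega)
      linarith
    exact mem_iUnion₂.2 ⟨n, by simpa using hn, a,
      ⟨z, hzT, mem_iInter₂.1 hzM n (Finset.mem_range.2 hn)⟩, rfl⟩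

theorem IsStratifiable.paracompactSpace {Y : Type u} [TopologicalSpace Y]
    (hY : IsStratifiable Y) : ParacompactSpace Y := by
  obtain ⟨S, hcl, hun, hmono, hS⟩ := hY.exists_monotone
  refine ⟨fun α U hU hcov => ?_⟩
  obtain ⟨_, _⟩ := exists_wellFoundedLT α
  let V : α → Opens Y := fun a => ⟨U a, hU a⟩
  let C : ℕ → α → Set Y := fun n a => (S (V a) n : Set Y) \ ⋃ b ∈ Iio a, U b
  have hmin : ∀ y, ∃ r, y ∈ U r ∧ ∀ b < r, y ∉ U b := by
    intro y
    have hne : {a | y ∈ U a}.Nonempty := by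
      have : y ∈ ⋃ a, U a := hcov ▸ mem_univ y
      exact mem_iUnion.1 this
    obtain ⟨r, hr, hr'⟩ := wellFounded_lt.has_min {a | y ∈ U a} hne
    exact ⟨r, hr, fun b hb hyb => hr' b hyb hb⟩
  have hC : ∀ n y, ∃ O ∈ 𝓝 y, ∃ r, ∀ a ≠ r, Disjoint O (C n a) := by
    intro n y
    obtain ⟨r, hr, hr'⟩ := hmin y
    let P : Opens Y := ⟨⋃ b ∈ Iio r, U b, isOpen_biUnion fun b _ => hU b⟩
    have hyP : y ∉ closure (S P n : Set Y) := by
      intro h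
      obtain ⟨b, hb, hyb⟩ := mem_iUnion₂.1 (hcl P n h)
      exact hr' b hb hyb
    refine ⟨U r ∩ (closure (S P n : Set Y))ᶜ,
      ((hU r).inter isClosed_closure.isOpen_compl).mem_nhds ⟨hr, hyP⟩, r, fun a har => ?_⟩
    rw [Set.disjoint_left]
    rintro z ⟨hz, hz'⟩ ⟨hza, hza'⟩
    rcases lt_or_gt_of_ne har with h | h
    · exact hz' (subset_closure (hmono (V a) P (subset_biUnion_of_mem (u := U) h) n hza))
    · exact hza' (mem_iUnion₂.2 ⟨r, h, hz⟩)
  have hCU : ∀ n a, closure (C n a) ⊆ U a := fun n a =>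
    (closure_mono sdiff_subset).trans (hcl (V a) n)
  choose h T hh hT hlf hTU hhT hpos using fun n => hY.exists_expansion hU (hCU n) (hC n)
  obtain ⟨R, hR, hRc, hRl, hRT⟩ := exists_locallyFinite_of_sigma hh hT hlf hhT fun y => by
    obtain ⟨r, hr, hr'⟩ := hmin y
    obtain ⟨n, hn⟩ := hun (V r) y hr
    refine ⟨n, hpos n r y ⟨hn, fun hy => ?_⟩⟩
    obtain ⟨b, hb, hyb⟩ := mem_iUnion₂.1 hy
    exact hr' b hb hyb
  let e : ULift.{u} ℕ × α → ℕ × α := fun b => (b.1.down, b.2)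
  have he : Function.Injective e := by
    rintro ⟨⟨n⟩, a⟩ ⟨⟨m⟩, b⟩ h
    simpa [e] using h
  refine ⟨ULift.{u} ℕ × α, R ∘ e, fun b => hR _, ?_, hRl.comp_injective he,
    fun b => ⟨b.2, (hRT _).trans (hTU _ _)⟩⟩
  refine eq_univ_of_forall fun y => ?_
  have : y ∈ ⋃ b, R b := hRc ▸ mem_univ y
  obtain ⟨⟨n, a⟩, hb⟩ := mem_iUnion.1 this
  exact mem_iUnion.2 ⟨(⟨n⟩, a), hb⟩

/-- Every point `x` off a closed set `X` has a neighbourhood `N x` and a companion `r x` in `X`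
such that, near `a ∈ X`, only those `N x` occur for which `r x` is near `a`. -/
theorem IsStratifiable.exists_anticover {Y : Type u} [TopologicalSpace Y] (hY : IsStratifiable Y)
    {X : Set Y} (hX : IsClosed X) (hne : X.Nonempty) :
    ∃ (N : (Xᶜ : Set Y) → Set Y) (r : (Xᶜ : Set Y) → X),
      (∀ x, IsOpen (N x)) ∧ (∀ x, (x : Y) ∈ N x) ∧
      ∀ a ∈ X, ∀ U : Set Y, IsOpen U → a ∈ U →
        ∃ V : Set Y, IsOpen V ∧ a ∈ V ∧ ∀ x, (N x ∩ V).Nonempty → (r x : Y) ∈ U := by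
  classical
  have := hY.t2
  obtain ⟨S, hcl, hun, hmono, hS⟩ := hY.exists_monotone
  choose! ν hν using hun
  let P : Y → Opens Y := fun x => ⟨{x}ᶜ, isOpen_compl_singleton⟩
  let B : Opens Y → Y → Opens Y := fun U x =>
    ⟨(S U (ν U x) : Set Y) \ closure (S (P x) (ν U x) : Set Y),
      (S U _).isOpen.sdiff isClosed_closure⟩
  have hB : ∀ U, ∀ x ∈ U, x ∈ B U x := fun U x hx =>
    ⟨hν U x hx, fun h => hcl (P x) _ h rfl⟩
  have key : ∀ (U V : Opens Y) (x y z : Y), z ∈ B U x → z ∈ B V y → ν U x ≤ ν V y → y ∈ U := by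
    intro U V x y z hz hz' hle
    by_contra hy
    have hUP : U ≤ P y := fun w hw hwy => hy (by rw [← mem_singleton_iff.1 hwy]; exact hw)
    exact hz'.2 (subset_closure (hmono U (P y) hUP _ (hS U hle hz.1)))
  let W : Opens Y := ⟨Xᶜ, hX.isOpen_compl⟩
  have hr : ∀ x : (Xᶜ : Set Y), ∃ r : X, ∀ a ∈ X, ∀ U : Opens Y, a ∈ U →
      (x : Y) ∈ B U a → (r : Y) ∈ U := by
    intro x
    let A : Set ℕ := {m | ∃ a ∈ X, ∃ U : Opens Y, (x : Y) ∈ B U a ∧ ν U a = m}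
    by_cases hA : A.Nonempty
    · have hb : BddAbove A := by
        refine ⟨ν W x, ?_⟩
        rintro _ ⟨a, ha, U, hxU, rfl⟩
        by_contra hlt
        exact key W U x a x (hB W x x.2) hxU (not_le.1 hlt).le ha
      obtain ⟨r, hr, U', hxU', hm⟩ := Nat.sSup_mem hA hb
      refine ⟨⟨r, hr⟩, fun a ha U _ hxU => key U U' a r x hxU hxU' ?_⟩
      rw [hm]
      exact le_csSup hb ⟨a, ha, U, hxU, rfl⟩
    · exact ⟨⟨hne.some, hne.some_mem⟩, fun a ha U _ hxU =>
        (hA ⟨_, a, ha, U, hxU, rfl⟩).elim⟩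
  choose r hr using hr
  refine ⟨fun x => B W x, r, fun x => (B W x).isOpen, fun x => hB W x x.2,
    fun a ha U hU haU => ?_⟩
  let U' : Opens Y := ⟨U, hU⟩
  refine ⟨B (B U' a) a, (B _ _).isOpen, hB _ _ (hB U' a haU), fun x => ?_⟩
  rintro ⟨z, hz, hz'⟩
  refine hr x a ha U' haU ?_
  rcases le_total (ν W x) (ν (B U' a) a) with h | h
  · exact absurd ha (key W (B U' a) x a z hz hz' h)
  · exact key (B U' a) W a x z hz' hz h

/-- Barycentric subdivision: an open cover of a paracompact Hausdorff space has a refinement that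
splits into countably many levels, each a disjoint union of open sets; a point in a set of the
`k`-th level lies in more than `k` members of the original cover. -/
theorem exists_levels {W : Type*} [TopologicalSpace W] [T2Space W] [ParacompactSpace W]
    {ι : Type*} {G : ι → Set W} (hG : ∀ s, IsOpen (G s)) (hcov : ∀ y, ∃ s, y ∈ G s) :
    ∃ (L : ℕ → Set W) (w : ℕ → W → ι), (∀ k, IsOpen (L k)) ∧ (∀ y, ∃ k, y ∈ L k) ∧
      (∀ k, ∀ y ∈ L k, y ∈ G (w k y)) ∧ (∀ k, ∀ y ∈ L k, ∀ᶠ z in 𝓝 y, w k z = w k y) ∧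
      ∀ k, ∀ y ∈ L k, (k : ℕ∞) + 1 ≤ {s | y ∈ G s}.encard := by
  classical
  obtain ⟨ρ, hρ⟩ := PartitionOfUnity.exists_isSubordinate (s := (univ : Set W)) isClosed_univ G hG
    fun y _ => mem_iUnion.2 (hcov y)
  have hρG : ∀ s y, 0 < ρ s y → y ∈ G s := fun s y h =>
    hρ s (subset_closure (Function.mem_support.2 h.ne'))
  let B : Finset ι → Set W := fun F =>
    {y | (∀ s ∈ F, 0 < ρ s y) ∧ ∀ s ∈ F, ∀ t ∉ F, ρ t y < ρ s y}
  have hBo : ∀ F, IsOpen (B F) := by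
    intro F
    rw [isOpen_iff_mem_nhds]
    rintro y ⟨hy, hy'⟩
    have h1 : ∀ᶠ z in 𝓝 y, ∀ s ∈ F, 0 < ρ s z := by
      rw [F.eventually_all]
      exact fun s hs => (isOpen_lt continuous_const (ρ s).continuous).mem_nhds (hy s hs)
    have h2 : ∀ᶠ z in 𝓝 y, ∀ t ∈ ρ.fintsupport y, t ∉ F → ∀ s ∈ F, ρ t z < ρ s z := by
      rw [Finset.eventually_all]
      intro t _
      by_cases ht : t ∈ F
      · exact Filter.Eventually.of_forall fun _ h => (h ht).elim
      · have : ∀ᶠ z in 𝓝 y, ∀ s ∈ F, ρ t z < ρ s z := by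
          rw [F.eventually_all]
          exact fun s hs =>
            (isOpen_lt (ρ t).continuous (ρ s).continuous).mem_nhds (hy' s hs t ht)
        exact this.mono fun _ h _ => h
    filter_upwards [h1, h2, ρ.eventually_finsupport_subset y] with z hz1 hz2 hz3
    refine ⟨hz1, fun s hs t ht => ?_⟩
    by_cases htz : t ∈ ρ.fintsupport y
    · exact hz2 t htz ht s hs
    · have : ρ t z = 0 := by
        by_contra hne
        exact htz (hz3 ((ρ.mem_finsupport z).2 hne))
      rw [this]
      exact hz1 s hs
  have hBu : ∀ F F' : Finset ι, F.card = F'.card → ∀ y ∈ B F, y ∈ B F' → F = F' := by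
    intro F F' hc y hy hy'
    by_contra hne
    obtain ⟨s, hs, hs'⟩ := Finset.not_subset.1 fun h => hne (Finset.eq_of_subset_of_card_le h hc.ge)
    obtain ⟨t, ht, ht'⟩ := Finset.not_subset.1 fun h =>
      hne (Finset.eq_of_subset_of_card_le h hc.le).symm
    exact lt_asymm (hy.2 s hs t ht') (hy'.2 t ht s hs')
  have hBc : ∀ y, ∃ F : Finset ι, F.Nonempty ∧ y ∈ B F := by
    intro y
    obtain ⟨s₀, hs₀⟩ := ρ.exists_pos (mem_univ y)
    obtain ⟨m, hm, hmax⟩ := (ρ.finsupport y).exists_max_image (fun s => ρ s y)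
      ⟨s₀, (ρ.mem_finsupport y).2 hs₀.ne'⟩
    have hmpos : 0 < ρ m y := lt_of_le_of_ne (ρ.nonneg m y) (Ne.symm ((ρ.mem_finsupport y).1 hm))
    refine ⟨(ρ.finsupport y).filter fun s => ρ s y = ρ m y,
      ⟨m, by simp only [Finset.mem_filter, hm, and_self]⟩,
      fun s hs => (Finset.mem_filter.1 hs).2 ▸ hmpos, fun s hs t ht => ?_⟩
    rw [(Finset.mem_filter.1 hs).2]
    by_cases hty : t ∈ ρ.finsupport y
    · exact lt_of_le_of_ne (hmax t hty) fun h => ht (Finset.mem_filter.2 ⟨hty, h⟩)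
    · have : ρ t y = 0 := by
        by_contra hne
        exact hty ((ρ.mem_finsupport y).2 hne)
      rwa [this]
  rcases isEmpty_or_nonempty ι with hι | hι
  · have : IsEmpty W := ⟨fun y => hι.elim (hcov y).choose⟩
    exact ⟨fun _ => ∅, fun _ y => this.elim y, fun _ => isOpen_empty, fun y => this.elim y,
      fun _ y => this.elim y, fun _ y => this.elim y, fun _ y => this.elim y⟩
  let c : Finset ι → ι := fun F => if h : F.Nonempty then h.choose else Classical.arbitrary ι
  have hc : ∀ F : Finset ι, F.Nonempty → c F ∈ F := by
    intro F hF
    simp only [c, dif_pos hF]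
    exact hF.choose_spec
  have hw : ∀ k y, ∃ s, ∀ F : Finset ι, F.card = k + 1 → y ∈ B F → c F = s := by
    intro k y
    by_cases h : ∃ F : Finset ι, F.card = k + 1 ∧ y ∈ B F
    · obtain ⟨F, hF, hy⟩ := h
      exact ⟨c F, fun F' hF' hy' => by rw [hBu F F' (hF.trans hF'.symm) y hy hy']⟩
    · exact ⟨Classical.arbitrary ι, fun F hF hy => (h ⟨F, hF, hy⟩).elim⟩
  choose w hw using hw
  have hL : ∀ k y, y ∈ (⋃ F ∈ {F : Finset ι | F.card = k + 1}, B F) ↔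
      ∃ F : Finset ι, F.card = k + 1 ∧ y ∈ B F := fun k y => by
    simp only [mem_iUnion, exists_prop, mem_ofPred_eq]
  refine ⟨fun k => ⋃ F ∈ {F : Finset ι | F.card = k + 1}, B F, w,
    fun k => isOpen_biUnion fun F _ => hBo F, fun y => ?_, fun k y hy => ?_, fun k y hy => ?_,
    fun k y hy => ?_⟩
  · obtain ⟨F, hF, hy⟩ := hBc y
    exact ⟨F.card - 1, (hL _ y).2 ⟨F, (Nat.sub_add_cancel hF.card_pos).symm, hy⟩⟩
  · obtain ⟨F, hF, hy⟩ := (hL k y).1 hy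
    rw [← hw k y F hF hy]
    exact hρG _ _ (hy.1 _ (hc F (Finset.card_pos.1 (by omega))))
  · obtain ⟨F, hF, hy⟩ := (hL k y).1 hy
    filter_upwards [(hBo F).mem_nhds hy] with z hz
    rw [← hw k y F hF hy, hw k z F hF hz]
  · obtain ⟨F, hF, hy⟩ := (hL k y).1 hy
    calc (k : ℕ∞) + 1 = (F : Set ι).encard := by rw [encard_coe_eq_coe_finsetCard, hF]; norm_cast
      _ ≤ _ := encard_le_encard fun s hs => hρG _ _ (hy.1 s hs)

theorem locallyFinite_Icc_even :
    LocallyFinite fun m : ℕ => Icc (2 * m : ℝ) (2 * m + 1) := by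
  intro x
  obtain ⟨N, hN⟩ := exists_nat_gt (x + 1)
  refine ⟨Iio (x + 1), Iio_mem_nhds (by linarith), (finite_lt_nat N).subset ?_⟩
  rintro m ⟨z, ⟨hz, -⟩, hz'⟩
  have hz' : z < x + 1 := hz'
  have : (m : ℝ) < N := by
    have : (0 : ℝ) ≤ m := by positivity
    linarith
  exact_mod_cast this

theorem Icc_even_unique {x : ℝ} {m m' : ℕ} (h : x ∈ Icc (2 * m : ℝ) (2 * m + 1))
    (h' : x ∈ Icc (2 * m' : ℝ) (2 * m' + 1)) : m = m' := by
  have h1 : (2 * m : ℝ) ≤ 2 * m' + 1 := h.1.trans h'.2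
  have h2 : (2 * m' : ℝ) ≤ 2 * m + 1 := h'.1.trans h.2
  have h1 : 2 * m ≤ 2 * m' + 1 := by exact_mod_cast h1
  have h2 : 2 * m' ≤ 2 * m + 1 := by exact_mod_cast h2
  omega

/-- In a space of covering dimension at most `n`, finitely many members of an open cover can be
shrunk so as to have order at most `n + 1` on a set that they cover. -/
theorem CoveringDimLE.exists_shrink_on {W : Type u} [TopologicalSpace W] {n : ℕ}
    (hn : CoveringDimLE W n) {L : ℕ → Set W} (hL : ∀ k, IsOpen (L k)) {P : Set W}
    (hP : IsClosed P) (K : ℕ) (hPL : ∀ y ∈ P, ∃ k ≤ K, y ∈ L k) :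
    ∃ H : ℕ → Set W, (∀ k, IsOpen (H k)) ∧ (∀ k, H k ⊆ L k) ∧ (∀ y ∈ P, ∃ k ≤ K, y ∈ H k) ∧
      ∀ y ∈ P, {k | y ∈ H k}.encard ≤ (n : ℕ∞) + 1 := by
  classical
  obtain ⟨𝒱, h𝒱f, h𝒱o, h𝒱c, h𝒱r, h𝒱n⟩ := hn (insert Pᶜ (L '' Iic K))
    (((finite_Iic K).image L).insert _) (by
      rintro _ (rfl | ⟨k, -, rfl⟩)
      exacts [hP.isOpen_compl, hL k]) (by
      refine eq_univ_of_forall fun y => ?_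
      by_cases hy : y ∈ P
      · obtain ⟨k, hk, hy⟩ := hPL y hy
        exact ⟨L k, Or.inr ⟨k, hk, rfl⟩, hy⟩
      · exact ⟨Pᶜ, Or.inl rfl, hy⟩)
  have hc : ∀ V ∈ 𝒱, (V ∩ P).Nonempty → ∃ k ≤ K, V ⊆ L k := by
    rintro V hV ⟨y, hyV, hyP⟩
    obtain ⟨U, (rfl | ⟨k, hk, rfl⟩), hVU⟩ := h𝒱r V hV
    · exact (hVU hyV hyP).elim
    · exact ⟨k, hk, hVU⟩
  choose! c hcK hcL using hc
  refine ⟨fun k => ⋃ V ∈ {V | V ∈ 𝒱 ∧ (V ∩ P).Nonempty ∧ c V = k}, V,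
    fun k => isOpen_biUnion fun V hV => h𝒱o V hV.1, fun k => ?_, fun y hy => ?_, fun y hy => ?_⟩
  · refine iUnion₂_subset ?_
    rintro V ⟨hV, hVP, rfl⟩
    exact hcL V hV hVP
  · obtain ⟨V, hV, hyV⟩ : y ∈ ⋃₀ 𝒱 := h𝒱c ▸ mem_univ y
    exact ⟨c V, hcK V hV ⟨y, hyV, hy⟩, mem_iUnion₂.2 ⟨V, ⟨hV, ⟨y, hyV, hy⟩, rfl⟩, hyV⟩⟩
  · refine le_trans ?_ (h𝒱n y)
    refine le_trans (encard_le_encard ?_) (encard_image_le c _)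
    intro k hk
    obtain ⟨V, ⟨hV, -, hVk⟩, hyV⟩ := mem_iUnion₂.1 hk
    exact ⟨V, ⟨hV, hyV⟩, hVk⟩

theorem CoveringDimLE.exists_shrink_even {W : Type u} [TopologicalSpace W] {n : ℕ}
    (hn : CoveringDimLE W n) {φ : W → ℝ} (hφ : Continuous φ) {L : ℕ → Set W}
    (hL : ∀ k, IsOpen (L k)) (hφL : ∀ y, ∃ k : ℕ, (k : ℝ) ≤ φ y ∧ y ∈ L k) :
    ∃ L' : ℕ → Set W, (∀ k, IsOpen (L' k)) ∧ (∀ k, L' k ⊆ L k) ∧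
      (∀ y, ∃ k : ℕ, (k : ℝ) ≤ φ y + 1 ∧ y ∈ L' k) ∧
      ∀ y, (∃ m : ℕ, φ y ∈ Icc (2 * m : ℝ) (2 * m + 1)) →
        {k | y ∈ L' k}.encard ≤ (n : ℕ∞) + 1 := by
  let P : ℕ → Set W := fun m => φ ⁻¹' Icc (2 * m : ℝ) (2 * m + 1)
  have hP : ∀ m, IsClosed (P m) := fun m => isClosed_Icc.preimage hφ
  have hPl : LocallyFinite P := locallyFinite_Icc_even.preimage_continuous hφ
  choose H hHo hHL hHc hHn using fun m => hn.exists_shrink_on hL (hP m) (2 * m + 1) (by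
    intro y hy
    obtain ⟨k, hk, hyk⟩ := hφL y
    refine ⟨k, ?_, hyk⟩
    have : (k : ℝ) ≤ 2 * m + 1 := hk.trans hy.2
    exact_mod_cast this)
  refine ⟨fun k => L k \ ⋃ m, (P m \ H m k), fun k => (hL k).sdiff
    ((hPl.subset fun m => sdiff_subset).isClosed_iUnion fun m => (hP m).sdiff (hHo m k)),
    fun k => sdiff_subset, fun y => ?_, ?_⟩
  · by_cases h : ∃ m, y ∈ P m
    · obtain ⟨m, hm⟩ := h
      obtain ⟨k, hk, hyk⟩ := hHc m y hm
      refine ⟨k, ?_, hHL m k hyk, fun hy => ?_⟩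
      · have h1 : (k : ℝ) ≤ 2 * m + 1 := by exact_mod_cast hk
        linarith [hm.1]
      · obtain ⟨m', hm', hy'⟩ := mem_iUnion.1 hy
        rw [← Icc_even_unique hm hm'] at hy'
        exact hy' hyk
    · obtain ⟨k, hk, hyk⟩ := hφL y
      refine ⟨k, hk.trans (by linarith), hyk, fun hy => ?_⟩
      obtain ⟨m, hm, -⟩ := mem_iUnion.1 hy
      exact h ⟨m, hm⟩
  · rintro y ⟨m, hm⟩
    refine le_trans (encard_le_encard fun k hk => ?_) (hHn m y hm)
    by_contra hy
    exact hk.2 (mem_iUnion.2 ⟨m, hm, hy⟩)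

/-- Dowker's theorem for countable covers of paracompact spaces. -/
theorem CoveringDimLE.exists_shrink_nat {W : Type u} [TopologicalSpace W] [T2Space W]
    [ParacompactSpace W] {n : ℕ} (hn : CoveringDimLE W n) {L : ℕ → Set W}
    (hL : ∀ k, IsOpen (L k)) (hcov : ∀ y, ∃ k, y ∈ L k) :
    ∃ L' : ℕ → Set W, (∀ k, IsOpen (L' k)) ∧ (∀ k, L' k ⊆ L k) ∧ (∀ y, ∃ k, y ∈ L' k) ∧
      ∀ y, {k | y ∈ L' k}.encard ≤ (n : ℕ∞) + 1 := by
  obtain ⟨ρ, hρ⟩ := PartitionOfUnity.exists_isSubordinate (s := (univ : Set W)) isClosed_univ L hL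
    fun y _ => mem_iUnion.2 (hcov y)
  let φ : W → ℝ := fun y => ∑ᶠ k : ℕ, ρ k y • (k : ℝ)
  have hφ : Continuous φ := ρ.continuous_finsum_smul fun k y _ => continuousAt_const
  have hφs : ∀ y, φ y = ∑ k ∈ ρ.finsupport y, ρ k y * k := fun y =>
    (ρ.sum_finsupport_smul_eq_finsum fun k _ => (k : ℝ)).symm
  have hφ0 : ∀ y, 0 ≤ φ y := fun y => by
    rw [hφs]
    exact Finset.sum_nonneg fun k _ => mul_nonneg (ρ.nonneg k y) k.cast_nonneg
  have hφL : ∀ y, ∃ k : ℕ, (k : ℝ) ≤ φ y ∧ y ∈ L k := by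
    intro y
    have h1 : ∑ k ∈ ρ.finsupport y, ρ k y = 1 := ρ.sum_finsupport (mem_univ y)
    by_contra! h
    have h2 : ∀ k ∈ ρ.finsupport y, ρ k y * φ y < ρ k y * k := by
      intro k hk
      have hk0 : ρ k y ≠ 0 := (ρ.mem_finsupport y).1 hk
      have hkL : y ∈ L k := hρ k (subset_closure (Function.mem_support.2 hk0))
      exact mul_lt_mul_of_pos_left (not_le.1 fun h' => h k h' hkL)
        (lt_of_le_of_ne (ρ.nonneg k y) hk0.symm)
    have hne : (ρ.finsupport y).Nonempty := by
      by_contra hne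
      rw [Finset.not_nonempty_iff_eq_empty.1 hne, Finset.sum_empty] at h1
      exact zero_ne_one h1
    have h3 := Finset.sum_lt_sum_of_nonempty hne h2
    rw [← Finset.sum_mul, h1, one_mul, ← hφs] at h3
    exact lt_irrefl _ h3
  obtain ⟨L₁, hL₁, hL₁L, hL₁c, hL₁n⟩ := hn.exists_shrink_even hφ hL hφL
  obtain ⟨L₂, hL₂, hL₂L, hL₂c, hL₂n⟩ :=
    hn.exists_shrink_even (φ := fun y => φ y + 1) (by fun_prop) hL₁ hL₁c
  refine ⟨L₂, hL₂, fun k => (hL₂L k).trans (hL₁L k), fun y => (hL₂c y).imp fun _ h => h.2,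
    fun y => ?_⟩
  have hfl := Nat.floor_le (hφ0 y)
  have hlt := (Nat.lt_floor_add_one (φ y)).le
  rcases Nat.even_or_odd' ⌊φ y⌋₊ with ⟨m, hm | hm⟩
  · rw [hm] at hfl hlt
    push_cast at hfl hlt
    exact (encard_le_encard fun k hk => hL₂L k hk).trans (hL₁n y ⟨m, hfl, hlt⟩)
  · rw [hm] at hfl hlt
    push_cast at hfl hlt
    refine hL₂n y ⟨m + 1, ?_, ?_⟩ <;> push_cast <;> linarith

theorem exists_levels_coveringDimLE {W : Type u} [TopologicalSpace W] [T2Space W]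
    [ParacompactSpace W] {ι : Type*} {G : ι → Set W} (hG : ∀ s, IsOpen (G s))
    (hcov : ∀ y, ∃ s, y ∈ G s) :
    ∃ (L : ℕ → Set W) (w : ℕ → W → ι), (∀ k, IsOpen (L k)) ∧ (∀ y, ∃ k, y ∈ L k) ∧
      (∀ k, ∀ y ∈ L k, y ∈ G (w k y)) ∧ (∀ k, ∀ y ∈ L k, ∀ᶠ z in 𝓝 y, w k z = w k y) ∧
      ∀ n, CoveringDimLE W n → ∀ k, (L k).Nonempty → k ≤ n := by
  classical
  obtain ⟨L, w, hL, hLc, hLG, hw, -⟩ := exists_levels hG hcov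
  by_cases hdim : ∃ n, CoveringDimLE W n
  swap
  · exact ⟨L, w, hL, hLc, hLG, hw, fun n hn => (hdim ⟨n, hn⟩).elim⟩
  obtain ⟨L', hL', hL'L, hL'c, hL'n⟩ := (Nat.find_spec hdim).exists_shrink_nat hL hLc
  obtain ⟨M, v, hM, hMc, hML, hv, hMn⟩ := exists_levels hL' hL'c
  refine ⟨M, fun k y => w (v k y) y, hM, hMc, fun k y hy => hLG _ y (hL'L _ (hML k y hy)),
    fun k y hy => ?_, fun n hn k ⟨y, hy⟩ => ?_⟩
  · filter_upwards [hv k y hy, hw _ y (hL'L _ (hML k y hy))] with z h1 h2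
    rw [h1, h2]
  · have h1 : (k : ℕ∞) + 1 ≤ (Nat.find hdim : ℕ∞) + 1 := (hMn k y hy).trans (hL'n y)
    have h2 : k + 1 ≤ Nat.find hdim + 1 := by exact_mod_cast h1
    have := Nat.find_min' hdim hn
    omega

namespace SqueezedJoin

variable {X : Type u}

theorem mk_zero (x y : X) : mk x y 0 = incl x := Quot.sound (SqueezedJoinRel.left x y x)

theorem mk_one (x y : X) : mk x y 1 = incl y :=
  (Quot.sound (SqueezedJoinRel.right x y y)).trans (Quot.sound (SqueezedJoinRel.diag y 1 0))

open Classical in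
/-- The set of endpoints needed to represent a point of the squeezed join. -/
noncomputable def endpoints : SqueezedJoin X → Set X :=
  Quot.lift (fun p => if p.2.2 = 0 then {p.1} else if p.2.2 = 1 then {p.2.1} else {p.1, p.2.1}) (by
    rintro _ _ (⟨x, y, y'⟩ | ⟨x, x', y⟩ | ⟨x, t, t'⟩) <;> simp)

theorem endpoints_incl (x : X) : endpoints (incl x) = {x} := by
  simp [endpoints, incl, mk]

theorem endpoints_mk {t : unitInterval} (h0 : t ≠ 0) (h1 : t ≠ 1) (x y : X) :
    endpoints (mk x y t) = {x, y} := by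
  simp [endpoints, mk, h0, h1]

theorem mk_eq_incl {x y z : X} {t : unitInterval} (h : mk x y t = incl z) :
    (t = 0 ∧ z = x) ∨ (t = 1 ∧ z = y) ∨ (x = z ∧ y = z) := by
  by_cases h0 : t = 0
  · subst h0
    exact Or.inl ⟨rfl, (incl_injective ((mk_zero x y).symm.trans h)).symm⟩
  by_cases h1 : t = 1
  · subst h1
    exact Or.inr (Or.inl ⟨rfl, (incl_injective ((mk_one x y).symm.trans h)).symm⟩)
  have hs : ({x, y} : Set X) = {z} := by
    rw [← endpoints_mk h0 h1, h, endpoints_incl]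
  exact Or.inr (Or.inr ⟨hs.subset (Or.inl rfl), hs.subset (Or.inr rfl)⟩)

theorem supp_mk_subset (x y : X) (t : unitInterval) : supp (mk x y t) ⊆ {x, y} := by
  have key : ∀ (x y : X) (t : unitInterval), mk x y t ∉ Set.range (incl : X → SqueezedJoin X) →
      endpoints (mk x y t) = {x, y} := fun x y t h =>
    endpoints_mk (fun h0 => h ⟨x, by rw [h0, mk_zero]⟩) (fun h1 => h ⟨y, by rw [h1, mk_one]⟩) x y
  rintro z (h | ⟨h, x', y', t', h', hz⟩)
  · rcases mk_eq_incl h with ⟨-, rfl⟩ | ⟨-, rfl⟩ | ⟨rfl, -⟩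
    exacts [Or.inl rfl, Or.inr rfl, Or.inl rfl]
  · rw [← key x y t h, h', key x' y' t' (h' ▸ h)]
    exact hz

theorem continuousAt_mk [TopologicalSpace X] {Z : Type*} [TopologicalSpace Z] {p q : Z → X}
    {t : Z → unitInterval} {z : Z} (ht : ContinuousAt t z) (hp : t z = 1 ∨ ContinuousAt p z)
    (hq : t z = 0 ∨ ContinuousAt q z) : ContinuousAt (fun z => mk (p z) (q z) (t z)) z := by
  intro V hV
  obtain ⟨O, hOV, hO, hz⟩ := mem_nhds_iff.1 hV
  suffices h : ∀ᶠ w in 𝓝 z, mk (p w) (q w) (t w) ∈ O from h.mono fun _ hw => hOV hw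
  replace hz : mk (p z) (q z) (t z) ∈ O := hz
  by_cases hr : mk (p z) (q z) (t z) ∈ Set.range (incl : X → SqueezedJoin X)
  · obtain ⟨x, hx⟩ := hr
    obtain ⟨U, hU, ε, hε, hUO⟩ := hO.2 x (hx ▸ hz)
    have hleft : t z = 0 → x = p z → ∀ᶠ w in 𝓝 z, mk (p w) (q w) (t w) ∈ O := by
      rintro h0 rfl
      have hp : ContinuousAt p z := hp.resolve_left (by simp [h0])
      have hlt : ∀ᶠ w in 𝓝 z, (t w : ℝ) < ε :=
        (continuous_subtype_val.continuousAt.comp ht).eventually_lt_const (by simpa [h0] using hε)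
      filter_upwards [hp hU, hlt] with w h1 h2
      exact hUO (Or.inl (Or.inr ⟨p w, h1, q w, mem_univ _, t w, h2, rfl⟩))
    have hright : t z = 1 → x = q z → ∀ᶠ w in 𝓝 z, mk (p w) (q w) (t w) ∈ O := by
      rintro h0 rfl
      have hq : ContinuousAt q z := hq.resolve_left (by simp [h0])
      have hlt : ∀ᶠ w in 𝓝 z, 1 - ε < (t w : ℝ) :=
        (continuous_subtype_val.continuousAt.comp ht).eventually_const_lt (by simpa [h0] using hε)
      filter_upwards [hq hU, hlt] with w h1 h2
      exact hUO (Or.inr ⟨p w, mem_univ _, q w, h1, t w, h2, rfl⟩)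
    rcases mk_eq_incl hx.symm with ⟨h0, h⟩ | ⟨h1, h⟩ | ⟨h, h'⟩
    · exact hleft h0 h
    · exact hright h1 h
    · by_cases h0 : t z = 0
      · exact hleft h0 h.symm
      by_cases h1 : t z = 1
      · exact hright h1 h'.symm
      have hpU : ∀ᶠ w in 𝓝 z, p w ∈ U := hp.resolve_left h1 (h ▸ hU)
      have hqU : ∀ᶠ w in 𝓝 z, q w ∈ U := hq.resolve_left h0 (h' ▸ hU)
      filter_upwards [hpU, hqU] with w h1 h2
      exact hUO (Or.inl (Or.inl ⟨p w, h1, q w, h2, t w, mem_univ _, rfl⟩))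
  · have h0 : t z ≠ 0 := fun h0 => hr ⟨p z, by rw [h0, mk_zero]⟩
    have h1 : t z ≠ 1 := fun h1 => hr ⟨q z, by rw [h1, mk_one]⟩
    obtain ⟨A, hA, B, hB, T, hT, hABT⟩ := hO.1 _ _ _ hr hz
    filter_upwards [hp.resolve_left h1 hA, hq.resolve_left h0 hB, ht hT] with w h1 h2 h3
    exact hABT ⟨p w, h1, q w, h2, t w, h3, rfl⟩

end SqueezedJoin

namespace SJPow

variable {X : Type u}

/-- The inclusion `X → SJ^k(X)`. -/
def vertex (x : X) : ∀ k, SJPow X k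
  | 0 => x
  | k + 1 => incl (vertex x k)

/-- The points of `SJ^k(X)` that are formed from points of `V`. -/
def hull (V : Set X) : ∀ k, Set (SJPow X k)
  | 0 => V
  | k + 1 => {c | ∃ a ∈ hull V k, ∃ b ∈ hull V k, ∃ t, c = mk a b t}

theorem mk_mem_hull {V : Set X} {k : ℕ} {a b : SJPow X k} (ha : a ∈ hull V k) (hb : b ∈ hull V k)
    (t : unitInterval) : mk a b t ∈ hull V (k + 1) := ⟨a, ha, b, hb, t, rfl⟩

theorem incl_mem_hull {V : Set X} {k : ℕ} {a : SJPow X k} (ha : a ∈ hull V k) :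
    incl a ∈ hull V (k + 1) := mk_mem_hull ha ha 0

theorem vertex_mem_hull {V : Set X} {x : X} (hx : x ∈ V) : ∀ k, vertex x k ∈ hull V k
  | 0 => hx
  | k + 1 => incl_mem_hull (vertex_mem_hull hx k)

theorem hull_mono {V V' : Set X} (h : V ⊆ V') : ∀ k, hull V k ⊆ hull V' k
  | 0 => h
  | k + 1 => by
    rintro _ ⟨a, ha, b, hb, t, rfl⟩
    exact mk_mem_hull (hull_mono h k ha) (hull_mono h k hb) t

theorem supp_subset_of_mem_hull {V : Set X} : ∀ {k : ℕ} {c : SJPow X k}, c ∈ hull V k →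
    supp k c ⊆ V
  | 0, _, hc => singleton_subset_iff.2 hc
  | k + 1, _, ⟨a, ha, b, hb, t, rfl⟩ => by
    refine iUnion₂_subset fun d hd => ?_
    rcases SqueezedJoin.supp_mk_subset a b t hd with rfl | rfl
    · exact supp_subset_of_mem_hull ha
    · exact supp_subset_of_mem_hull hb

theorem exists_hull_subset [TopologicalSpace X] (x : X) : ∀ {k : ℕ} {O : Set (SJPow X k)},
    IsOpen O → vertex x k ∈ O → ∃ V ∈ 𝓝 x, hull V k ⊆ O
  | 0, O, hO, hx => ⟨O, hO.mem_nhds hx, Subset.rfl⟩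
  | k + 1, O, hO, hx => by
    obtain ⟨U, hU, ε, -, hUO⟩ := hO.2 (vertex x k) hx
    obtain ⟨U', hU'U, hU', hxU'⟩ := mem_nhds_iff.1 hU
    obtain ⟨V, hV, hVU⟩ := exists_hull_subset x hU' hxU'
    refine ⟨V, hV, ?_⟩
    rintro _ ⟨a, ha, b, hb, t, rfl⟩
    exact hUO (Or.inl (Or.inl ⟨a, hU'U (hVU ha), b, hU'U (hVU hb), t, mem_univ _, rfl⟩))

/-- The iterated join of the points `p 0, p 1, …, p k` with (unnormalised) weights
`σ 0, …, σ k`. -/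
noncomputable def combo (σ : ℕ → ℝ) (p : ℕ → X) : ∀ k, SJPow X k
  | 0 => p 0
  | k + 1 => mk (combo σ p k) (vertex (p (k + 1)) k)
      (Set.projIcc 0 1 zero_le_one (σ (k + 1) / ∑ i ∈ Finset.range (k + 2), σ i))

theorem combo_succ_of_eq_zero {σ : ℕ → ℝ} (p : ℕ → X) {k : ℕ} (h : σ (k + 1) = 0) :
    combo σ p (k + 1) = incl (combo σ p k) := by
  rw [combo, h, zero_div, Set.projIcc_left]
  exact SqueezedJoin.mk_zero _ _

theorem combo_mem_hull {σ : ℕ → ℝ} {p : ℕ → X} (hσ : ∀ i, 0 ≤ σ i) {V : Set X}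
    (hV : ∀ i, 0 < σ i → p i ∈ V) : ∀ k, 0 < ∑ i ∈ Finset.range (k + 1), σ i →
    combo σ p k ∈ hull V k
  | 0, h => hV 0 (by simpa using h)
  | k + 1, h => by
    rcases (hσ (k + 1)).eq_or_lt with h0 | h0
    · rw [combo_succ_of_eq_zero p h0.symm]
      refine incl_mem_hull (combo_mem_hull hσ hV k ?_)
      rwa [Finset.sum_range_succ, ← h0, add_zero] at h
    · rcases (Finset.sum_nonneg fun i _ => hσ i : 0 ≤ ∑ i ∈ Finset.range (k + 1), σ i).eq_or_lt
        with h1 | h1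
      · have : combo σ p (k + 1) = incl (vertex (p (k + 1)) k) := by
          rw [combo, Finset.sum_range_succ, ← h1, zero_add, div_self h0.ne', Set.projIcc_right]
          exact SqueezedJoin.mk_one _ _
        rw [this]
        exact incl_mem_hull (vertex_mem_hull (hV _ h0) k)
      · exact mk_mem_hull (combo_mem_hull hσ hV k h1) (vertex_mem_hull (hV _ h0) k) _

theorem continuousAt_combo [TopologicalSpace X] {Z : Type*} [TopologicalSpace Z]
    {σ : ℕ → Z → ℝ} {p : ℕ → Z → X} (hc : ∀ i, Continuous (σ i)) (hσ : ∀ i z, 0 ≤ σ i z) {z : Z}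
    (hp : ∀ i, 0 < σ i z → ∀ᶠ w in 𝓝 z, p i w = p i z) :
    ∀ k, 0 < ∑ i ∈ Finset.range (k + 1), σ i z →
      ContinuousAt (fun w => combo (fun i => σ i w) (fun i => p i w) k) z
  | 0, h => by
    refine (continuousAt_const (y := p 0 z)).congr ?_
    filter_upwards [hp 0 (by simpa using h)] with w hw
    exact hw.symm
  | k + 1, h => by
    have hsum : Continuous fun w => ∑ i ∈ Finset.range (k + 2), σ i w :=
      continuous_finsetSum _ fun i _ => hc i
    refine SqueezedJoin.continuousAt_mk (X := SJPow X k)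
      (continuous_projIcc.continuousAt.comp ((hc (k + 1)).continuousAt.div hsum.continuousAt h.ne'))
      ?_ ?_
    · rcases (Finset.sum_nonneg fun i _ => hσ i z :
        0 ≤ ∑ i ∈ Finset.range (k + 1), σ i z).eq_or_lt with h1 | h1
      · left
        rw [Finset.sum_range_succ, ← h1, zero_add] at h
        show Set.projIcc _ _ _ (σ (k + 1) z / ∑ i ∈ Finset.range (k + 2), σ i z) = 1
        rw [Finset.sum_range_succ, ← h1, zero_add, div_self h.ne', Set.projIcc_right]
        rfl
      · exact Or.inr (continuousAt_combo hc hσ hp k h1)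
    · rcases (hσ (k + 1) z).eq_or_lt with h0 | h0
      · left
        show Set.projIcc _ _ _ (σ (k + 1) z / ∑ i ∈ Finset.range (k + 2), σ i z) = 0
        rw [← h0, zero_div, Set.projIcc_left]
        rfl
      · right
        refine (continuousAt_const (y := vertex (p (k + 1) z) k)).congr ?_
        filter_upwards [hp (k + 1) h0] with w hw
        rw [← hw]

end SJPow

namespace SJInfty

variable {X : Type u}

theorem of_incl {n : ℕ} (a : SJPow X n) : of (n + 1) (SJPow.incl a) = of n a :=
  (Quot.sound (SJInftyRel.incl n a)).symm

theorem of_vertex (x : X) : ∀ k, of k (SJPow.vertex x k) = incl x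
  | 0 => rfl
  | k + 1 => (of_incl _).trans (of_vertex x k)

theorem continuous_of [TopologicalSpace X] (n : ℕ) : Continuous (of n : SJPow X n → SJInfty X) :=
  continuous_generateFrom_iff.2 fun _ hU => hU.2 n

theorem of_combo_eq {σ : ℕ → ℝ} (p : ℕ → X) {K : ℕ} (h : ∀ i, K < i → σ i = 0) {k : ℕ}
    (hk : K ≤ k) : of k (SJPow.combo σ p k) = of K (SJPow.combo σ p K) := by
  induction k, hk using Nat.le_induction with
  | base => rfl
  | succ k hk ih => rw [SJPow.combo_succ_of_eq_zero p (h _ (by omega)), of_incl, ih]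

theorem exists_hull_subset [TopologicalSpace X] {U : Set (SJInfty X)} (hU : IsConvex U)
    (hUo : ∀ n : ℕ, IsOpen (of n ⁻¹' U)) {x : X} (hx : incl x ∈ U) :
    ∃ V, IsOpen V ∧ x ∈ V ∧ ∀ k, ∀ c ∈ SJPow.hull V k, of k c ∈ U := by
  obtain ⟨n, hn⟩ := hU
  obtain ⟨V', hV', hV'U⟩ := SJPow.exists_hull_subset x (hUo n)
    (show of n (SJPow.vertex x n) ∈ U by rwa [of_vertex])
  obtain ⟨V, hVV', hV, hxV⟩ := mem_nhds_iff.1 hV'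
  have hge : ∀ k, n ≤ k → ∀ c ∈ SJPow.hull V k, of k c ∈ U := by
    intro k hk
    induction k, hk using Nat.le_induction with
    | base => exact fun c hc => hV'U (SJPow.hull_mono hVV' n hc)
    | succ k hk ih =>
      rintro _ ⟨a, ha, b, hb, t, rfl⟩
      exact hn k hk a b (ih a ha) (ih b hb) t
  have hle : ∀ j k, n ≤ k + j → ∀ c ∈ SJPow.hull V k, of k c ∈ U := by
    intro j
    induction j with
    | zero => exact hge
    | succ j ih =>
      intro k hk c hc
      rw [← of_incl]
      exact ih (k + 1) (by omega) _ (SJPow.incl_mem_hull hc)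
  exact ⟨V, hV, hxV, fun k => hle n k (by omega)⟩

end SJInfty

/-- The data on `Y \ X` from which the extension is built: companions in `X` of each point, varying
upper semicontinuously and converging to `a` near each `a ∈ X`, and weights `σ k` on vertices
`p k` chosen among the companions. -/
theorem IsStratifiable.exists_weights {Y : Type u} [TopologicalSpace Y] (hY : IsStratifiable Y)
    {X : Set Y} (hX : IsClosed X) (hne : X.Nonempty) :
    ∃ (c : (Xᶜ : Set Y) → Finset X) (σ : ℕ → (Xᶜ : Set Y) → ℝ) (p : ℕ → (Xᶜ : Set Y) → X),
      (∀ y, ∀ᶠ z in 𝓝 y, c z ⊆ c y) ∧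
      (∀ a ∈ X, ∀ U : Set Y, IsOpen U → a ∈ U → ∃ V : Set Y, IsOpen V ∧ a ∈ V ∧
        ∀ y : (Xᶜ : Set Y), (y : Y) ∈ V → ∀ x ∈ c y, (x : Y) ∈ U) ∧
      (∀ k, Continuous (σ k)) ∧ (∀ k y, 0 ≤ σ k y) ∧ (∀ y, ∃ k, 0 < σ k y) ∧
      (∀ y, ∃ K, ∀ᶠ z in 𝓝 y, ∀ k, K < k → σ k z = 0) ∧
      (∀ k y, 0 < σ k y → p k y ∈ c y ∧ ∀ᶠ z in 𝓝 y, p k z = p k y) ∧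
      ∀ n, CoveringDimLE (Xᶜ : Set Y) n → ∀ k y, 0 < σ k y → k ≤ n := by
  classical
  have hW := hY.of_isOpen hX.isOpen_compl
  have := hW.t2
  have := hW.normalSpace
  have := hW.paracompactSpace
  obtain ⟨N, r, hN, hNx, hNr⟩ := hY.exists_anticover hX hne
  obtain ⟨ρ, hρ⟩ := PartitionOfUnity.exists_isSubordinate (s := (univ : Set (Xᶜ : Set Y)))
    isClosed_univ (fun x => Subtype.val ⁻¹' N x)
    (fun x => (hN x).preimage continuous_subtype_val) fun y _ => mem_iUnion.2 ⟨y, hNx y⟩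
  obtain ⟨L, w, hL, hLc, hLw, hw, hdim⟩ := exists_levels_coveringDimLE
    (G := fun s => {y | 0 < ρ s y}) (fun s => isOpen_lt continuous_const (ρ s).continuous)
    fun y => ρ.exists_pos (mem_univ y)
  obtain ⟨μ, hμ⟩ := PartitionOfUnity.exists_isSubordinate (s := (univ : Set (Xᶜ : Set Y)))
    isClosed_univ L hL fun y _ => mem_iUnion.2 (hLc y)
  have hμL : ∀ k y, 0 < μ k y → y ∈ L k := fun k y h =>
    hμ k (subset_closure (Function.mem_support.2 h.ne'))
  refine ⟨fun y => (ρ.fintsupport y).image r, fun k y => μ k y, fun k y => r (w k y),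
    fun y => ?_, fun a ha U hU haU => ?_, fun k => (μ k).continuous, fun k y => μ.nonneg k y,
    fun y => μ.exists_pos (mem_univ y), fun y => ?_, fun k y hk => ⟨?_, ?_⟩,
    fun n hn k y hk => hdim n hn k ⟨y, hμL k y hk⟩⟩
  · exact (ρ.eventually_fintsupport_subset y).mono fun z hz => Finset.image_subset_image hz
  · obtain ⟨V, hV, haV, hVU⟩ := hNr a ha U hU haU
    refine ⟨V, hV, haV, fun y hy x hx => ?_⟩
    obtain ⟨s, hs, rfl⟩ := Finset.mem_image.1 hx
    exact hVU s ⟨y, hρ s ((ρ.mem_fintsupport_iff y s).1 hs), hy⟩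
  · refine ⟨(μ.fintsupport y).sup id, ?_⟩
    filter_upwards [μ.eventually_finsupport_subset y] with z hz k hk
    by_contra hne
    exact absurd (Finset.le_sup (f := id) (hz ((μ.mem_finsupport z).2 hne))) (not_le.2 hk)
  · exact Finset.mem_image_of_mem r (ρ.finsupport_subset_fintsupport y
      ((ρ.mem_finsupport y).2 (hLw k y (hμL k y hk)).ne'))
  · exact (hw k y (hμL k y hk)).mono fun z hz => congrArg r hz

theorem lemma3p1 {Y : Type u} [TopologicalSpace Y] (hY : IsStratifiable Y)
    (X : Set Y) (hX : IsClosed X) (hne : X.Nonempty) :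
    ∃ (f : Y → SJInfty X) (u : Y → Finset X),
      Continuous f ∧
      (∀ x : X, f x = SJInfty.incl x) ∧
      (∀ U : Set X, IsOpen U → IsOpen {y : Y | (u y : Set X) ⊆ U}) ∧
      (∀ x : X, u x = {x}) ∧
      (∀ y : Y, SJInfty.supp (f y) ⊆ (u y : Set X)) ∧
      (∀ n : ℕ, CoveringDimLE (Xᶜ : Set Y) n → Set.range f ⊆ Set.range (SJInfty.of (X := X) n)) := by
  classical
  obtain ⟨c, σ, p, hc, hcX, hσc, hσ, hσpos, hσK, hp, hdim⟩ := hY.exists_weights hX hne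
  choose K hK using hσK
  let g : (Xᶜ : Set Y) → SJInfty X := fun y =>
    SJInfty.of (K y) (SJPow.combo (fun i => σ i y) (fun i => p i y) (K y))
  let f : Y → SJInfty X := fun y => if h : y ∈ X then SJInfty.incl ⟨y, h⟩ else g ⟨y, h⟩
  let u : Y → Finset X := fun y => if h : y ∈ X then {⟨y, h⟩} else c ⟨y, h⟩
  have hfX : ∀ x : X, f x = SJInfty.incl x := fun x => dif_pos x.2
  have huX : ∀ x : X, u x = {x} := fun x => dif_pos x.2
  have hfW : ∀ y : (Xᶜ : Set Y), f y = g y := fun y => dif_neg y.2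
  have huW : ∀ y : (Xᶜ : Set Y), u y = c y := fun y => dif_neg y.2
  have hle : ∀ y k, (∀ i, k < i → σ i y = 0) → 0 < ∑ i ∈ Finset.range (k + 1), σ i y := by
    intro y k hk
    obtain ⟨i, hi⟩ := hσpos y
    have hik : i ≤ k := not_lt.1 fun h => hi.ne' (hk i h)
    exact Finset.sum_pos' (fun i _ => hσ i y) ⟨i, Finset.mem_range.2 (by omega), hi⟩
  have hg : ∀ y k, (∀ i, k < i → σ i y = 0) →
      g y = SJInfty.of k (SJPow.combo (fun i => σ i y) (fun i => p i y) k) := by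
    intro y k hk
    have hKy : ∀ i, K y < i → σ i y = 0 := (hK y).self_of_nhds
    rcases le_total (K y) k with h | h
    · exact (SJInfty.of_combo_eq (σ := fun i => σ i y) (fun i => p i y) hKy h).symm
    · exact SJInfty.of_combo_eq (σ := fun i => σ i y) (fun i => p i y) hk h
  have hghull : ∀ y, ∃ k, ∃ a ∈ SJPow.hull (c y : Set X) k, g y = SJInfty.of k a := fun y =>
    ⟨K y, _, SJPow.combo_mem_hull (fun i => hσ i y) (fun i hi => (hp i y hi).1) _
      (hle y _ (hK y).self_of_nhds), rfl⟩
  have hfhull : ∀ y, ∃ k, ∃ a ∈ SJPow.hull (u y : Set X) k, f y = SJInfty.of k a := by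
    intro y
    by_cases hy : y ∈ X
    · exact ⟨0, ⟨y, hy⟩, by rw [huX ⟨y, hy⟩, Finset.coe_singleton]; rfl, hfX ⟨y, hy⟩⟩
    · rw [hfW ⟨y, hy⟩, huW ⟨y, hy⟩]
      exact hghull ⟨y, hy⟩
  have hu : ∀ U : Set X, IsOpen U → IsOpen {y : Y | (u y : Set X) ⊆ U} := by
    intro U hU
    rw [isOpen_iff_mem_nhds]
    intro y hy
    by_cases hyX : y ∈ X
    · obtain ⟨U', hU', rfl⟩ := isOpen_induced_iff.1 hU
      have hyU : y ∈ U' := hy (by rw [huX ⟨y, hyX⟩, Finset.coe_singleton]; rfl)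
      obtain ⟨V, hV, hyV, hVU⟩ := hcX y hyX U' hU' hyU
      filter_upwards [hV.mem_nhds hyV, hU'.mem_nhds hyU] with z hzV hzU
      by_cases hz : z ∈ X
      · rw [huX ⟨z, hz⟩, Finset.coe_singleton, singleton_subset_iff]
        exact hzU
      · rw [huW ⟨z, hz⟩]
        exact fun x hx => hVU ⟨z, hz⟩ hzV x hx
    · have h : ∀ᶠ z : (Xᶜ : Set Y) in 𝓝 ⟨y, hyX⟩, (u z : Set X) ⊆ U := by
        filter_upwards [hc ⟨y, hyX⟩] with z hz
        rw [mem_ofPred_eq, huW ⟨y, hyX⟩] at hy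
        rw [huW]
        exact (Finset.coe_subset.2 hz).trans hy
      rw [← hX.isOpen_compl.isOpenEmbedding_subtypeVal.map_nhds_eq ⟨y, hyX⟩]
      exact h
  refine ⟨f, u, continuous_iff_continuousAt.2 fun y => ?_, hfX, hu, huX, fun y => ?_,
    fun n hn => ?_⟩
  · by_cases hy : y ∈ X
    · refine tendsto_nhds_generateFrom_iff.2 fun U hU hyU => ?_
      obtain ⟨V, hV, hyV, hVU⟩ := SJInfty.exists_hull_subset hU.1 hU.2 (x := ⟨y, hy⟩)
        (by rwa [← hfX])
      filter_upwards [(hu V hV).mem_nhds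
        (by rw [mem_ofPred_eq, huX ⟨y, hy⟩, Finset.coe_singleton, singleton_subset_iff]
            exact hyV)] with z hz
      obtain ⟨k, a, ha, hza⟩ := hfhull z
      rw [mem_preimage, hza]
      exact hVU k a (SJPow.hull_mono hz k ha)
    · let y' : (Xᶜ : Set Y) := ⟨y, hy⟩
      rw [← hX.isOpen_compl.isOpenEmbedding_subtypeVal.continuousAt_iff (x := y')]
      have hcomp : ContinuousAt (fun z => SJInfty.of (K y')
          (SJPow.combo (fun i => σ i z) (fun i => p i z) (K y'))) y' :=
        (SJInfty.continuous_of (K y')).continuousAt.comp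
          (SJPow.continuousAt_combo hσc hσ (fun i hi => (hp i y' hi).2) _
            (hle y' _ (hK y').self_of_nhds))
      refine hcomp.congr ?_
      filter_upwards [hK y'] with z hz
      rw [Function.comp_apply, hfW, hg z _ hz]
  · obtain ⟨k, a, ha, hya⟩ := hfhull y
    rw [hya]
    exact SJPow.supp_subset_of_mem_hull ha
  · rintro _ ⟨y, rfl⟩
    by_cases hy : y ∈ X
    · exact ⟨SJPow.vertex ⟨y, hy⟩ n, by rw [SJInfty.of_vertex, ← hfX]⟩
    · refine ⟨_, ((hfW ⟨y, hy⟩).trans (hg _ n fun i hi => ?_)).symm⟩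
      by_contra hne
      exact absurd (hdim n hn i _ (lt_of_le_of_ne (hσ i _) (Ne.symm hne))) (not_le.2 hi)
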